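/- Let $(R,\mathfrak m)$ be a Noetherian local ring with infinite residue field, let $F$ be a free $R$-module of finite positive rank, and let $M\subseteq F$ be a (necessarily finitely generated) submodule with $\ell_R(F/M)<\infty$. Let $I(M)=\mathrm{Fitt}_0(F/M)$ be the $0$-th Fitting ideal of $F/M$. Let $\mathscr R(M)=\bigoplus_{n\ge 0}M^n$ be the Rees algebra of $M$, that is, the image of $\mathrm{Sym}_R(M)\to\mathrm{Sym}_R(F)$, where $M^n$ is its component of degree $n$ and products of submodules of $F$ are formed in $\mathrm{Sym}_R(F)$. Let $s=\dim\bigl(\mathscr R(M)/\mathfrak m\mathscr R(M)\bigr)$ be the analytic spread of $M$, and assume that $s\ge 1$. For an integer $e$, say that a function $f$ of $n$ has eventual degree $\le e$ if there is a polynomial $P\in\mathbb Q[X]$ that is zero or of degree at most $e$ such that $f(n)$ is finite and $f(n)=P(n)$ for all large $n$ (so for $e=-1$ this means $f(n)=0$ for all large $n$). Then for each $k=1,\dots,s$ there is a unique largest $R$-module $M_{[k]}$ with $I(M)M\subseteq M_{[k]}\subseteq M$ such that the function $$n\longmapsto \ell_R\!\left(\frac{M_{[k]}\,M^{n-1}}{I(M)\,M^n}\right)\qquad(n\ge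 1)$$ has eventual degree $\le s-(k+1)$. Here "largest" means that $M_{[k]}$ contains every submodule $L$ with $I(M)M\subseteq L\subseteq M$ for which $n\mapsto \ell_R(LM^{n-1}/I(M)M^n)$ has eventual degree $\le s-(k+1)$. Moreover, $$I(M)M\subseteq M_{[s]}\subseteq M_{[s-1]}\subseteq\cdots\subseteq M_{[1]}\subseteq M .$$ -/

import Mathlib

open scoped Polynomial

namespace CoeffModule

universe u v

section Fitting

variable (R : Type u) [CommRing R] (N : Type v) [AddCommGroup N] [Module R N]

/-- The zeroth Fitting ideal `Fitt₀(N)` of a finitely generated module `N`: the ideal generated by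
the maximal minors of relation matrices, i.e. by the determinants of all `n × n` matrices whose
rows are `R`-linear relations among the members of a generating system `x₁, …, xₙ` of `N`.
The ideal obtained from one finite generating system does not depend on the system,
so all of them are used at once. -/
def fittingIdealZero : Ideal R :=
  Ideal.span {a : R | ∃ (n : ℕ) (x : Fin n → N), Submodule.span R (Set.range x) = ⊤ ∧
    ∃ A : Matrix (Fin n) (Fin n) R, (∀ i, ∑ j, A i j • x j = 0) ∧ A.det = a}

end Fitting

section Rees

variable {R : Type u} [CommRing R] {F : Type v} [AddCommGroup F] [Module R F]

/-- The copy of a submodule `M ⊆ F` in degree one of `Sym_R(F)`. -/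
noncomputable def degOne (M : Submodule R F) : Submodule R (SymmetricAlgebra R F) :=
  M.map (SymmetricAlgebra.ι R F)

/-- The Rees algebra `𝓡(M)` of `M ⊆ F`: the image of the map `Sym_R(M) → Sym_R(F)`
induced by the inclusion. -/
noncomputable def reesAlg (M : Submodule R F) : Subalgebra R (SymmetricAlgebra R F) :=
  (SymmetricAlgebra.lift ((SymmetricAlgebra.ι R F).comp M.subtype)).range

/-- `I(M)`, the zeroth Fitting ideal of `F / M`. -/
noncomputable def fitt (M : Submodule R F) : Ideal R :=
  fittingIdealZero R (F ⧸ M)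

/-- The length `ℓ_R(L M^{n-1} / I(M) M^n)` for `n ≥ 1`. Products and powers are formed in
`Sym_R(F)`, so `M^n` is the degree `n` component of the Rees algebra of `M`.
The value at `n = 0` has no meaning and is never used. -/
noncomputable def quotLength (M L : Submodule R F) (n : ℕ) : ℕ∞ :=
  Module.length R
    (↥(degOne L * degOne M ^ (n - 1)) ⧸
      (fitt M • degOne M ^ n).submoduleOf (degOne L * degOne M ^ (n - 1)))

variable [IsLocalRing R]

/-- The fiber cone `𝓡(M) / 𝔪 𝓡(M)`. -/
abbrev FiberCone (M : Submodule R F) : Type (max u v) :=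
  ↥(reesAlg M) ⧸ (IsLocalRing.maximalIdeal R).map (algebraMap R ↥(reesAlg M))

/-- The analytic spread of `M`: the Krull dimension of its fiber cone. -/
noncomputable def analyticSpread (M : Submodule R F) : WithBot ℕ∞ :=
  ringKrullDim (FiberCone M)

end Rees

/-- For all large `n` the value `f n` is finite and equal to `P(n)`, where `P` is a polynomial of
degree at most `e`; the zero polynomial counts as having degree at most `e` for every `e`. -/
def EventualDegreeLE (f : ℕ → ℕ∞) (e : ℤ) : Prop :=
  ∃ P : ℚ[X], (P = 0 ∨ (P.natDegree : ℤ) ≤ e) ∧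
    ∀ᶠ n : ℕ in Filter.atTop, ∃ l : ℕ, f n = (l : ℕ∞) ∧ (l : ℚ) = P.eval (n : ℚ)

/-- The submodules `L` of `F` with `I(M)M ⊆ L ⊆ M` for which `n ↦ ℓ_R(L M^{n-1} / I(M) M^n)` has
eventual degree at most `s - (k + 1)`. -/
def coeffCandidates {R : Type u} [CommRing R] {F : Type v} [AddCommGroup F] [Module R F]
    (M : Submodule R F) (s k : ℕ) : Set (Submodule R F) :=
  {L | fitt M • M ≤ L ∧ L ≤ M ∧ EventualDegreeLE (quotLength M L) ((s : ℤ) - ((k : ℤ) + 1))}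

end CoeffModule

/-! The candidates contain I(M)M and are closed under sums. As F is Noetherian, a maximal candidate
exists, and closure under sums makes it the greatest. The chain of inclusions holds because the
degree bound weakens as k decreases. Closure under sums: length is subadditive in L, so the function
of L + L' is bounded by a sum of two polynomials of small degree. This bounds its degree once it is
itself known to be eventually polynomial, which is Hilbert's theorem for the graded module with
pieces L M^{n-1} / I(M) M^n (`eventuallyPolynomial_quotLength`). These lengths are finite because
ℓ(F/M) < ∞ makes R/I(M) Artinian. -/

namespace CoeffModule

open Filter

/-! ### Lengths of subquotients -/

section RelLength

variable {R : Type*} [CommRing R] {S : Type*} [AddCommGroup S] [Module R S]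

/-- The length of the quotient `U / (U ∩ V)` of submodules of a fixed module. -/
noncomputable def relLength (U V : Submodule R S) : ℕ∞ :=
  Module.length R (↥U ⧸ V.submoduleOf U)

lemma relLength_eq_zero {U V : Submodule R S} (h : U ≤ V) : relLength U V = 0 := by
  rw [relLength, Module.length_eq_zero_iff, Submodule.Quotient.subsingleton_iff,
    Submodule.submoduleOf_eq_top]
  exact h

lemma relLength_add {V W U : Submodule R S} (hVW : V ≤ W) (hWU : W ≤ U) :
    relLength U V = relLength W V + relLength U W := by
  have hVW' : V.submoduleOf U ≤ W.submoduleOf U := Submodule.comap_mono hVW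
  have hcomap : V.submoduleOf W ≤ (V.submoduleOf U).comap (Submodule.inclusion hWU) := by
    intro x hx; exact hx
  refine Module.length_eq_add_of_exact
    ((V.submoduleOf W).mapQ (V.submoduleOf U) (Submodule.inclusion hWU) hcomap)
    (Submodule.factor hVW') ?_ (Submodule.factor_surjective hVW') ?_
  · rw [← LinearMap.ker_eq_bot, Submodule.ker_mapQ]
    exact (Submodule.mkQ_map_self _)
  · rw [LinearMap.exact_iff]
    ext x
    obtain ⟨x, rfl⟩ := Submodule.Quotient.mk_surjective _ x
    constructor
    · intro hx
      have hx' : (x : S) ∈ W := by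
        have : (Submodule.Quotient.mk x : ↥U ⧸ W.submoduleOf U) = 0 := hx
        rwa [Submodule.Quotient.mk_eq_zero] at this
      exact ⟨Submodule.Quotient.mk ⟨x, hx'⟩, rfl⟩
    · rintro ⟨y, hy⟩
      obtain ⟨y, rfl⟩ := Submodule.Quotient.mk_surjective _ y
      rw [← hy]
      change (Submodule.Quotient.mk (Submodule.inclusion hWU y) : ↥U ⧸ W.submoduleOf U) = 0
      rw [Submodule.Quotient.mk_eq_zero]
      exact y.2

/-- First isomorphism theorem for U → (f(U) + V)/V. The case f = id gives subadditivity; f =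
multiplication by a generator drives Hilbert's theorem. -/
lemma relLength_inf_comap (f : S →ₗ[R] S) (U V : Submodule R S) :
    relLength U (U ⊓ V.comap f) = relLength (U.map f ⊔ V) V := by
  let g : ↥U →ₗ[R] ↥(U.map f ⊔ V) ⧸ V.submoduleOf (U.map f ⊔ V) :=
    (Submodule.mkQ _).comp ((f.comp U.subtype).codRestrict (U.map f ⊔ V)
      fun x => Submodule.mem_sup_left ⟨x, x.2, rfl⟩)
  have hker : LinearMap.ker g = (U ⊓ V.comap f).submoduleOf U := by
    ext x
    rw [LinearMap.mem_ker]
    change Submodule.Quotient.mk _ = _ ↔ _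
    rw [Submodule.Quotient.mk_eq_zero]
    simp [Submodule.submoduleOf]
  have hsurj : Function.Surjective g := by
    intro y
    obtain ⟨⟨y, hy⟩, rfl⟩ := Submodule.Quotient.mk_surjective _ y
    obtain ⟨_, ⟨u, hu, rfl⟩, v, hv, rfl⟩ := Submodule.mem_sup.1 hy
    refine ⟨⟨u, hu⟩, ?_⟩
    refine (Submodule.Quotient.eq _).2 ?_
    simpa [Submodule.submoduleOf] using hv
  rw [relLength, ← hker]
  exact (g.quotKerEquivOfSurjective hsurj).length_eq

lemma relLength_mono {V U U' : Submodule R S} (hV : V ≤ U) (h : U ≤ U') :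
    relLength U V ≤ relLength U' V := by
  rw [relLength_add hV h]; exact le_self_add

lemma relLength_anti {V V' U : Submodule R S} (h : V ≤ V') (hU : V' ≤ U) :
    relLength U V' ≤ relLength U V := by
  rw [relLength_add h hU]; exact le_add_self

lemma relLength_sup_le {V U U' : Submodule R S} (hU : V ≤ U) (hU' : V ≤ U') :
    relLength (U ⊔ U') V ≤ relLength U V + relLength U' V := by
  rw [relLength_add hU le_sup_left]
  gcongr
  have h := relLength_inf_comap LinearMap.id U' U
  rw [Submodule.comap_id, Submodule.map_id, sup_comm] at h
  rw [← h]
  exact relLength_anti (le_inf hU' hU) inf_le_left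

end RelLength

/-! ### Eventually polynomial functions -/

section Polynomial

/-- Every rational polynomial is the forward difference of a rational polynomial. -/
lemma exists_forward_difference (P : ℚ[X]) :
    ∃ Q : ℚ[X], ∀ x : ℚ, Q.eval (1 + x) - Q.eval x = P.eval x := by
  induction P using Polynomial.induction_on' with
  | add p q hp hq =>
    obtain ⟨p', hp⟩ := hp
    obtain ⟨q', hq⟩ := hq
    refine ⟨p' + q', fun x => ?_⟩
    rw [Polynomial.eval_add, Polynomial.eval_add, Polynomial.eval_add, ← hp, ← hq]
    ring
  | monomial n a =>
    -- B_{n+1}(1 + x) - B_{n+1}(x) = (n + 1) xⁿ.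
    refine ⟨Polynomial.C (a / (n + 1)) * Polynomial.bernoulli (n + 1), fun x => ?_⟩
    rw [Polynomial.eval_mul, Polynomial.eval_mul, Polynomial.bernoulli_eval_one_add]
    have : (n : ℚ) + 1 ≠ 0 := by positivity
    simp
    field_simp
    ring

/-- A sequence of extended natural numbers that is eventually finite and given by a rational
polynomial. -/
def EventuallyPolynomial (f : ℕ → ℕ∞) : Prop :=
  ∃ P : ℚ[X], ∀ᶠ n : ℕ in atTop, ∃ l : ℕ, f n = (l : ℕ∞) ∧ (l : ℚ) = P.eval (n : ℚ)

/-- A function with eventually polynomial differences c(n+1) - k(n) is eventually polynomial; the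
additive form avoids subtraction in `ℕ∞`. -/
lemma eventuallyPolynomial_of_add_eq {f c k : ℕ → ℕ∞} (hf : ∀ n, f n ≠ ⊤)
    (h : ∀ n, f (n + 1) + k n = f n + c (n + 1)) (hc : EventuallyPolynomial c)
    (hk : EventuallyPolynomial k) : EventuallyPolynomial f := by
  obtain ⟨P, hP⟩ := hc
  obtain ⟨Q, hQ⟩ := hk
  obtain ⟨T, hT⟩ := exists_forward_difference (P.comp (Polynomial.X + 1) - Q)
  obtain ⟨N, hN⟩ := eventually_atTop.1 (hP.and hQ)
  lift f to ℕ → ℕ using hf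
  refine ⟨T + Polynomial.C (f N - T.eval (N : ℚ)), eventually_atTop.2 ⟨N, fun n hn => ?_⟩⟩
  refine ⟨f n, rfl, ?_⟩
  induction n, hn using Nat.le_induction with
  | base => simp
  | succ n hn ih =>
    obtain ⟨⟨a, ha, ha'⟩, -⟩ := hN (n + 1) (by omega)
    obtain ⟨-, ⟨b, hb, hb'⟩⟩ := hN n hn
    have h1 := h n
    rw [ha, hb] at h1
    dsimp only at h1
    have h2 : f (n + 1) + b = f n + a := by exact_mod_cast h1
    have h3 : (f (n + 1) : ℚ) + b = f n + a := by exact_mod_cast h2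
    have h4 := hT n
    simp only [Polynomial.eval_sub, Polynomial.eval_comp, Polynomial.eval_add, Polynomial.eval_X,
      Polynomial.eval_one, Polynomial.eval_C] at h4 ih ⊢
    push_cast at ha' ⊢
    rw [← ha', ← hb', add_comm 1 (n : ℚ)] at h4
    linarith

/-- Otherwise Q/P tends to 0, while Q/P ≥ 1 wherever P > 0. -/
lemma degree_le_of_eventually_le {P Q : ℚ[X]}
    (h : ∀ᶠ n : ℕ in atTop, 0 ≤ P.eval (n : ℚ) ∧ P.eval (n : ℚ) ≤ Q.eval (n : ℚ)) :
    P.degree ≤ Q.degree := by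
  by_contra! hlt
  have hP : P ≠ 0 := by rintro rfl; simp at hlt
  have h1 := (Polynomial.div_tendsto_atTop_zero_of_degree_lt Q P hlt).comp
    (tendsto_natCast_atTop_atTop (R := ℚ))
  have h2 := h1.eventually (eventually_lt_nhds (zero_lt_one (α := ℚ)))
  have h3 := (tendsto_natCast_atTop_atTop (R := ℚ)).eventually
    (P.eventually_atTop_not_isRoot hP)
  obtain ⟨n, ⟨h0, hle⟩, h2, h3⟩ := (h.and (h2.and h3)).exists
  have hpos : 0 < P.eval (n : ℚ) := lt_of_le_of_ne h0 (Ne.symm h3)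
  simp only [Function.comp] at h2
  rw [div_lt_one hpos] at h2
  linarith

lemma EventualDegreeLE.of_le_add {f g h : ℕ → ℕ∞} {e : ℤ} (hf : EventuallyPolynomial f)
    (hg : EventualDegreeLE g e) (hh : EventualDegreeLE h e)
    (hle : ∀ᶠ n in atTop, f n ≤ g n + h n) : EventualDegreeLE f e := by
  obtain ⟨P, hP⟩ := hf
  obtain ⟨Q, hQe, hQ⟩ := hg
  obtain ⟨T, hTe, hT⟩ := hh
  refine ⟨P, ?_, hP⟩
  have hdeg : P.degree ≤ (Q + T).degree := by
    apply degree_le_of_eventually_le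
    filter_upwards [hP, hQ, hT, hle]
    rintro n ⟨a, ha, ha'⟩ ⟨b, hb, hb'⟩ ⟨c, hc, hc'⟩ hn
    rw [ha, hb, hc] at hn
    have : a ≤ b + c := by exact_mod_cast hn
    rw [Polynomial.eval_add, ← ha', ← hb', ← hc']
    exact ⟨by positivity, by exact_mod_cast this⟩
  by_cases hP0 : P = 0
  · exact Or.inl hP0
  right
  have hn := Polynomial.natDegree_le_natDegree hdeg
  by_cases hQ0 : Q = 0
  · by_cases hT0 : T = 0
    · subst hQ0 hT0
      simp [hP0] at hdeg
    · rw [hQ0, zero_add] at hn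
      have := hTe.resolve_left hT0
      omega
  · have h1 := hQe.resolve_left hQ0
    by_cases hT0 : T = 0
    · rw [hT0, add_zero] at hn
      omega
    · have h2 := hTe.resolve_left hT0
      have := Polynomial.natDegree_add_le Q T
      omega

end Polynomial

/-! ### Hilbert's theorem -/

section Hilbert

variable {R : Type*} [CommRing R] {S : Type*} [AddCommGroup S] [Module R S]

/-- Every sequence of submodules between `V` and `U` that is stable under the degree one operators
in `T` is, modulo `V`, eventually generated by `T` from the preceding degree. -/
def StablyGenerated (T : Finset (Module.End R S)) (U V : ℕ → Submodule R S) : Prop :=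
  ∀ W : ℕ → Submodule R S, (∀ n, V n ≤ W n) → (∀ n, W n ≤ U n) →
    (∀ x ∈ T, ∀ n, (W n).map x ≤ W (n + 1)) →
    ∀ᶠ n in atTop, W (n + 1) ≤ (⨆ x ∈ T, (W n).map x) ⊔ V (n + 1)

/-- **Hilbert's theorem**: lengths of the graded pieces of a Noetherian graded module over a
ring generated in degree one are eventually given by a polynomial. The graded module is presented
by its pieces `U n / V n`, with submodules `V n ≤ U n` of one fixed module. -/
theorem eventuallyPolynomial_relLength (T : Finset (Module.End R S))
    (hT : ∀ x ∈ T, ∀ y ∈ T, Commute x y) (U V : ℕ → Submodule R S)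
    (hVU : ∀ n, V n ≤ U n) (hU : ∀ x ∈ T, ∀ n, (U n).map x ≤ U (n + 1))
    (hV : ∀ x ∈ T, ∀ n, (V n).map x ≤ V (n + 1)) (hfin : ∀ n, relLength (U n) (V n) ≠ ⊤)
    (hgen : StablyGenerated T U V) :
    EventuallyPolynomial fun n => relLength (U n) (V n) := by
  classical
  -- Multiplication by x : Uₙ/Vₙ → Uₙ₊₁/Vₙ₊₁ has kernel Kₙ/Vₙ and cokernel Uₙ₊₁/V'ₙ₊₁. Since x kills
  -- K/V and U/V', the smaller set of operators suffices for both.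
  induction T using Finset.induction_on generalizing U V with
  | empty =>
    refine ⟨0, ?_⟩
    have h := hgen U hVU (fun _ => le_rfl) (by simp)
    obtain ⟨N, hN⟩ := eventually_atTop.1 h
    refine eventually_atTop.2 ⟨N + 1, fun n hn => ⟨0, ?_, by simp⟩⟩
    obtain ⟨n, rfl⟩ : ∃ m, n = m + 1 := ⟨n - 1, by omega⟩
    exact relLength_eq_zero (by simpa using hN n (by omega))
  | insert x T hxT ih =>
    have hx := Finset.mem_insert_self x T
    have hsub : ∀ y ∈ T, y ∈ insert x T := fun y hy => Finset.mem_insert_of_mem hy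
    have ih' := ih fun y hy z hz => hT y (hsub y hy) z (hsub z hz)
    let V' : ℕ → Submodule R S := fun n => Nat.casesOn n (V 0) fun m => (U m).map x ⊔ V (m + 1)
    let K : ℕ → Submodule R S := fun n => U n ⊓ (V (n + 1)).comap x
    have hVV' : ∀ n, V n ≤ V' n := by
      rintro (_ | n)
      · exact le_rfl
      · exact le_sup_right
    have hV'U : ∀ n, V' n ≤ U n := by
      rintro (_ | n)
      · exact hVU 0
      · exact sup_le (hU x hx n) (hVU _)
    have hVK : ∀ n, V n ≤ K n := fun n =>
      le_inf (hVU n) (Submodule.map_le_iff_le_comap.1 (hV x hx n))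
    have hKU : ∀ n, K n ≤ U n := fun n => inf_le_left
    have hxV' : ∀ n, (U n).map x ≤ V' (n + 1) := fun n => le_sup_left
    have hxK : ∀ n, (K n).map x ≤ V (n + 1) := fun n =>
      Submodule.map_le_iff_le_comap.2 inf_le_right
    have comm_apply : ∀ y ∈ T, ∀ s, y (x s) = x (y s) := fun y hy s =>
      LinearMap.congr_fun (hT y (hsub y hy) x hx).eq s
    refine eventuallyPolynomial_of_add_eq (c := fun n => relLength (U n) (V' n))
      (k := fun n => relLength (K n) (V n)) hfin ?_ (ih' U V' hV'U ?_ ?_ ?_ ?_)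
      (ih' K V hVK ?_ ?_ ?_ ?_)
    · intro n
      have h1 := relLength_add (hVK n) (hKU n)
      have h2 := relLength_add (hVV' (n + 1)) (hV'U (n + 1))
      have h3 : relLength (U n) (K n) = relLength (V' (n + 1)) (V (n + 1)) :=
        relLength_inf_comap x (U n) (V (n + 1))
      rw [h1, h2, h3]
      ring
    · exact fun y hy => hU y (hsub y hy)
    · intro y hy n
      rcases n with _ | n
      · exact (hV y (hsub y hy) 0).trans (hVV' 1)
      · change Submodule.map y ((U n).map x ⊔ V (n + 1)) ≤ _
        rw [Submodule.map_sup]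
        refine sup_le ?_ ((hV y (hsub y hy) _).trans (hVV' _))
        refine le_trans ?_ (hxV' (n + 1))
        rintro _ ⟨_, ⟨u, hu, rfl⟩, rfl⟩
        exact ⟨y u, hU y (hsub y hy) n ⟨u, hu, rfl⟩, (comm_apply y hy u).symm⟩
    · exact fun n => ne_top_of_le_ne_top (hfin n) (relLength_anti (hVV' n) (hV'U n))
    · intro W hVW hWU hW
      -- W is automatically x-stable, and the x-term among the generators is absorbed by V'.
      have hWx : ∀ n, (W n).map x ≤ V' (n + 1) := fun n =>
        (Submodule.map_mono (hWU n)).trans (hxV' n)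
      filter_upwards [hgen W (fun n => (hVV' n).trans (hVW n)) hWU (by
        intro y hy n
        rcases Finset.mem_insert.1 hy with rfl | hy
        · exact (hWx n).trans (hVW (n + 1))
        · exact hW y hy n)] with n hn
      refine hn.trans ?_
      rw [Finset.iSup_insert]
      exact sup_le (sup_le ((hWx n).trans le_sup_right) le_sup_left)
        ((hVV' _).trans le_sup_right)
    · intro y hy n
      refine le_inf ((Submodule.map_mono inf_le_left).trans (hU y (hsub y hy) n)) ?_
      rintro _ ⟨u, hu, rfl⟩
      change x (y u) ∈ V (n + 1 + 1)
      rw [← comm_apply y hy]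
      exact hV y (hsub y hy) _ ⟨_, hu.2, rfl⟩
    · exact fun y hy => hV y (hsub y hy)
    · exact fun n => ne_top_of_le_ne_top (hfin n) (relLength_mono (hVK n) (hKU n))
    · intro W hVW hWK hW
      have hWx : ∀ n, (W n).map x ≤ V (n + 1) := fun n =>
        (Submodule.map_mono (hWK n)).trans (hxK n)
      filter_upwards [hgen W hVW (fun n => (hWK n).trans (hKU n)) (by
        intro y hy n
        rcases Finset.mem_insert.1 hy with rfl | hy
        · exact (hWx n).trans (hVW (n + 1))
        · exact hW y hy n)] with n hn
      refine hn.trans ?_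
      rw [Finset.iSup_insert]
      exact sup_le (sup_le ((hWx n).trans le_sup_right) le_sup_left) le_sup_right

end Hilbert

/-! ### Rees algebras and graded ideals -/

section Graded

variable {R : Type*} [CommRing R] {A : Type*} [CommRing A] [Algebra R A]

lemma span_mul_le_iff {s : Set A} {W X : Submodule R A} :
    Submodule.span R s * W ≤ X ↔ ∀ x ∈ s, W.map (LinearMap.mulLeft R x) ≤ X := by
  rw [Submodule.mul_le]
  constructor
  · rintro h x hx _ ⟨w, hw, rfl⟩
    exact h x (Submodule.subset_span hx) w hw
  · intro h m hm w hw
    induction hm using Submodule.span_induction with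
    | mem x hx => exact h x hx ⟨w, hw, rfl⟩
    | zero => simp
    | add x y _ _ hx hy => rw [add_mul]; exact X.add_mem hx hy
    | smul r x _ hx => rw [smul_mul_assoc]; exact X.smul_mem r hx

lemma ideal_smul_mul (J : Ideal R) (M N : Submodule R A) : J • (M * N) = (J • M) * N := by
  apply le_antisymm
  · rw [Submodule.smul_le]
    intro r hr x hx
    refine Submodule.mul_induction_on hx (fun m hm n hn => ?_) fun x y hx hy => ?_
    · rw [← smul_mul_assoc]
      exact Submodule.mul_mem_mul (Submodule.smul_mem_smul hr hm) hn
    · rw [smul_add]; exact add_mem hx hy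
  · rw [Submodule.mul_le]
    intro m hm n hn
    refine Submodule.smul_induction_on hm (fun r hr x hx => ?_) fun x y hx hy => ?_
    · rw [smul_mul_assoc]
      exact Submodule.smul_mem_smul hr (Submodule.mul_mem_mul hx hn)
    · rw [add_mul]; exact add_mem hx hy

lemma pow_mul_le_of_mul_le {M : Submodule R A} {W : ℕ → Submodule R A}
    (h : ∀ n, M * W n ≤ W (n + 1)) (i n : ℕ) : M ^ i * W n ≤ W (n + i) := by
  induction i with
  | zero => simp
  | succ i ih =>
    rw [pow_succ', mul_assoc]
    exact (mul_le_mul' le_rfl ih).trans (h _)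

/-- The Rees algebra of a submodule `M` of a commutative algebra `A`, as a subalgebra of `A[X]`. -/
noncomputable def polyRees (M : Submodule R A) : Subalgebra R A[X] :=
  Algebra.adjoin R (M.map ((Polynomial.monomial 1).restrictScalars R) : Set A[X])

lemma isNoetherianRing_polyRees [IsNoetherianRing R] {M : Submodule R A} (hM : M.FG) :
    IsNoetherianRing (polyRees M) := by
  classical
  obtain ⟨s, rfl⟩ := hM
  refine isNoetherianRing_of_fg ⟨s.image (Polynomial.monomial 1), ?_⟩
  rw [polyRees, Submodule.map_span, Algebra.adjoin_span, Finset.coe_image]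
  rfl

lemma monomial_mem_polyRees {M : Submodule R A} {n : ℕ} {a : A} (ha : a ∈ M ^ n) :
    Polynomial.monomial n a ∈ polyRees M := by
  induction n generalizing a with
  | zero =>
    rw [pow_zero] at ha
    obtain ⟨r, rfl⟩ := Submodule.mem_one.1 ha
    exact (polyRees M).algebraMap_mem r
  | succ n ih =>
    rw [pow_succ'] at ha
    refine Submodule.mul_induction_on ha (fun x hx y hy => ?_) fun x y hx hy => ?_
    · rw [add_comm n 1, ← Polynomial.monomial_mul_monomial]
      exact mul_mem (Algebra.subset_adjoin ⟨x, hx, rfl⟩) (ih hy)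
    · rw [map_add]; exact add_mem hx hy

/-- With `monomial_mem_polyRees`, this identifies the degree i part with Mⁱ; the variable records
degrees, so A needs no grading. -/
lemma coeff_mem_of_mem_polyRees {M : Submodule R A} {f : A[X]} (hf : f ∈ polyRees M) (i : ℕ) :
    f.coeff i ∈ M ^ i := by
  induction hf using Algebra.adjoin_induction generalizing i with
  | mem x hx =>
    obtain ⟨a, ha, rfl⟩ := hx
    change (Polynomial.monomial 1 a).coeff i ∈ _
    rw [Polynomial.coeff_monomial]
    split_ifs with h
    · rw [← h, pow_one]; exact ha
    · exact zero_mem _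
  | algebraMap r =>
    rw [Polynomial.algebraMap_apply, Polynomial.coeff_C]
    split_ifs with h
    · rw [h, pow_zero]; exact Submodule.mem_one.2 ⟨r, rfl⟩
    · exact zero_mem _
  | add x y _ _ hx hy => rw [Polynomial.coeff_add]; exact add_mem (hx i) (hy i)
  | mul x y _ _ hx hy =>
    rw [Polynomial.coeff_mul]
    refine sum_mem fun p hp => ?_
    rw [← Finset.HasAntidiagonal.mem_antidiagonal.1 hp, pow_add]
    exact Submodule.mul_mem_mul (hx _) (hy _)

/-- A homogeneous ideal of the Rees algebra of a finitely generated module is generated by its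
components of bounded degree. -/
theorem eventually_le_mul [IsNoetherianRing R] {M : Submodule R A} (hM : M.FG)
    {W : ℕ → Submodule R A} (hW : ∀ n, W n ≤ M ^ n) (hmul : ∀ n, M * W n ≤ W (n + 1)) :
    ∀ᶠ n in atTop, W (n + 1) ≤ M * W n := by
  have := isNoetherianRing_polyRees hM
  let G : ℕ → Set (polyRees M) := fun m =>
    {f | ∃ n ≤ m, ∃ w ∈ W n, (f : A[X]) = Polynomial.monomial n w}
  let J : ℕ →o Ideal (polyRees M) :=
    ⟨fun m => Ideal.span (G m), fun a b hab => Ideal.span_mono (by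
      rintro f ⟨n, hn, h⟩
      exact ⟨n, hn.trans hab, h⟩)⟩
  -- Generators of degree at most m reach degree m + 1 only through M · W m. The multiplier b lets
  -- the induction pass through scalar multiples.
  have key : ∀ m, ∀ f ∈ J m, ∀ b : polyRees M,
      ((b * f : polyRees M) : A[X]).coeff (m + 1) ∈ M * W m := by
    intro m f hf
    induction hf using Submodule.span_induction with
    | mem f hf =>
      obtain ⟨n, hn, w, hw, hf⟩ := hf
      intro b
      obtain ⟨k, rfl⟩ := Nat.exists_eq_add_of_le hn
      rw [Subalgebra.coe_mul, hf, show n + k + 1 = (k + 1) + n by ring,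
        Polynomial.coeff_mul_monomial]
      refine (?_ : M ^ (k + 1) * W n ≤ M * W (n + k))
        (Submodule.mul_mem_mul (coeff_mem_of_mem_polyRees b.2 _) hw)
      rw [pow_succ', mul_assoc]
      exact mul_le_mul' le_rfl (pow_mul_le_of_mul_le hmul k n)
    | zero => intro b; simp
    | add x y _ _ hx hy =>
      intro b
      rw [mul_add, Subalgebra.coe_add, Polynomial.coeff_add]
      exact add_mem (hx b) (hy b)
    | smul a x _ hx =>
      intro b
      rw [smul_eq_mul, ← mul_assoc]
      exact hx _
  obtain ⟨N, hN⟩ := monotone_stabilizes_iff_noetherian.2 this J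
  refine eventually_atTop.2 ⟨N, fun n hn w hw => ?_⟩
  have hmem : (⟨Polynomial.monomial (n + 1) w, monomial_mem_polyRees (hW _ hw)⟩ : polyRees M) ∈
      J n := by
    rw [← hN n hn, hN (n + 1) (by omega)]
    exact Ideal.subset_span ⟨n + 1, le_rfl, w, hw, rfl⟩
  simpa using key n _ hmem 1

/-- Hilbert polynomials of `L Mⁿ / J Mⁿ⁺¹`. -/
theorem eventuallyPolynomial_relLength_mul_pow [IsNoetherianRing R] {M L : Submodule R A}
    (hM : M.FG) {J : Ideal R} (hJL : J • M ≤ L) (hLM : L ≤ M)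
    (hfin : ∀ n, relLength (L * M ^ n) (J • M ^ (n + 1)) ≠ ⊤) :
    EventuallyPolynomial fun n => relLength (L * M ^ n) (J • M ^ (n + 1)) := by
  classical
  have hM' := hM
  obtain ⟨s, hs⟩ := hM'
  have map_le : ∀ {W X : Submodule R A}, M * W ≤ X ↔
      ∀ x ∈ s, W.map (LinearMap.mulLeft R x) ≤ X := by
    intro W X
    rw [← hs, span_mul_le_iff]
    rfl
  have ball_image : ∀ {p : Module.End R A → Prop},
      (∀ x ∈ s.image (LinearMap.mulLeft R), p x) ↔ ∀ x ∈ s, p (LinearMap.mulLeft R x) := by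
    intro p; simp
  refine eventuallyPolynomial_relLength (s.image (LinearMap.mulLeft R)) ?_
    (fun n => L * M ^ n) (fun n => J • M ^ (n + 1)) ?_ ?_ ?_ hfin ?_
  · rw [ball_image]
    intro x _
    rw [ball_image]
    intro y _
    refine LinearMap.ext fun a => ?_
    simp [mul_left_comm]
  · intro n
    rw [pow_succ', ideal_smul_mul]
    exact mul_le_mul' hJL le_rfl
  · rw [ball_image]
    intro x hx n
    refine map_le.1 ?_ x hx
    rw [pow_succ', mul_left_comm]
  · rw [ball_image]
    intro x hx n
    refine map_le.1 ?_ x hx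
    rw [pow_succ' M (n + 1), mul_comm, ← ideal_smul_mul, mul_comm]
  · intro W hVW hWU hW
    rw [ball_image] at hW
    have hmul : ∀ n, M * W n ≤ W (n + 1) := fun n => map_le.2 fun x hx => hW x hx n
    -- W n lies in Mⁿ⁺¹, so it is shifted up one degree, with zero in degree 0.
    have h := eventually_le_mul hM (W := fun n => Nat.casesOn n ⊥ W) (by
      rintro (_ | n)
      · exact bot_le
      · refine (hWU n).trans ?_
        rw [pow_succ']
        exact mul_le_mul' hLM le_rfl) (by
      rintro (_ | n)
      · simp
      · exact hmul n)
    filter_upwards [(tendsto_add_atTop_nat 1).eventually h] with n hn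
    refine (show W (n + 1) ≤ M * W n from hn).trans (le_sup_of_le_left ?_)
    rw [map_le]
    intro x hx
    exact le_iSup₂_of_le (LinearMap.mulLeft R x) (Finset.mem_image_of_mem _ hx) le_rfl

end Graded

/-! ### The Fitting ideal and finite length -/

section FiniteLength

variable {R : Type*} [CommRing R]

/-- With n generators, the scalar matrix a is a relation matrix of determinant aⁿ. -/
lemma pow_mem_fittingIdealZero {N : Type*} [AddCommGroup N] [Module R N] [Module.Finite R N] {a : R}
    (ha : a ∈ Module.annihilator R N) : ∃ n : ℕ, a ^ n ∈ fittingIdealZero R N := by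
  obtain ⟨n, x, hx⟩ := Module.Finite.exists_fin (R := R) (M := N)
  refine ⟨n, Ideal.subset_span ⟨n, x, hx, Matrix.diagonal fun _ => a, fun i => ?_, by simp⟩⟩
  simp [Matrix.diagonal_apply, Module.mem_annihilator.1 ha]

/-- The chain 𝔪ⁿN stabilizes, and Nakayama makes its stable value zero. -/
lemma exists_maximalIdeal_pow_le_annihilator [IsLocalRing R] {N : Type*} [AddCommGroup N]
    [Module R N] [IsArtinian R N] [IsNoetherian R N] :
    ∃ n : ℕ, IsLocalRing.maximalIdeal R ^ n ≤ Module.annihilator R N := by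
  let f : ℕ →o (Submodule R N)ᵒᵈ :=
    ⟨fun n => OrderDual.toDual (IsLocalRing.maximalIdeal R ^ n • (⊤ : Submodule R N)),
      fun a b hab => Submodule.smul_mono_left (Ideal.pow_le_pow_right hab)⟩
  obtain ⟨n, hn⟩ := IsArtinian.monotone_stabilizes f
  have h : IsLocalRing.maximalIdeal R ^ n • (⊤ : Submodule R N) =
      IsLocalRing.maximalIdeal R ^ (n + 1) • (⊤ : Submodule R N) := hn (n + 1) (by omega)
  refine ⟨n, ?_⟩
  rw [← Submodule.annihilator_top, Submodule.le_annihilator_iff]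
  refine Submodule.eq_bot_of_le_smul_of_le_jacobson_bot (IsLocalRing.maximalIdeal R) _
    (IsNoetherian.noetherian _) ?_ (IsLocalRing.maximalIdeal_le_jacobson _)
  rw [← Submodule.mul_smul, ← pow_succ', ← h]

lemma isArtinianRing_quotient_fittingIdealZero [IsLocalRing R] [IsNoetherianRing R] {N : Type*}
    [AddCommGroup N] [Module R N] (hN : Module.length R N ≠ ⊤) :
    IsArtinianRing (R ⧸ fittingIdealZero R N) := by
  obtain ⟨_, _⟩ := isFiniteLength_iff_isNoetherian_isArtinian.1 (Module.length_ne_top_iff.1 hN)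
  rw [isArtinianRing_iff_krullDimLE_zero, Ring.krullDimLE_zero_iff]
  intro p hp
  obtain ⟨n, hn⟩ := exists_maximalIdeal_pow_le_annihilator (R := R) (N := N)
  let π := Ideal.Quotient.mk (fittingIdealZero R N)
  -- Each element of 𝔪 has a power annihilating N, hence a power in the Fitting ideal.
  have hle : IsLocalRing.maximalIdeal R ≤ p.comap π := by
    intro a ha
    obtain ⟨m, hm⟩ := pow_mem_fittingIdealZero (hn (Ideal.pow_mem_pow ha n))
    rw [← pow_mul] at hm
    refine (hp.comap π).mem_of_pow_mem (n * m) ?_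
    rw [Ideal.mem_comap, Ideal.Quotient.eq_zero_iff_mem.2 hm]
    exact p.zero_mem
  have hmax : (p.comap π).IsMaximal := by
    rw [← (IsLocalRing.maximalIdeal.isMaximal R).eq_of_le (hp.comap π).ne_top hle]
    infer_instance
  have := Ideal.map_comap_of_surjective π Ideal.Quotient.mk_surjective p
  rw [← this]
  exact (Ideal.map_eq_top_or_isMaximal_of_surjective π Ideal.Quotient.mk_surjective hmax).resolve_left
    (by rw [this]; exact hp.ne_top)

/-- U/JU is finitely generated over the Artinian ring R/J. -/
lemma relLength_smul_ne_top {S : Type*} [AddCommGroup S] [Module R S] {J : Ideal R}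
    [IsArtinianRing (R ⧸ J)] {U : Submodule R S} (hU : U.FG) : relLength U (J • U) ≠ ⊤ := by
  have : Module.Finite R U := Module.Finite.iff_fg.2 hU
  have hker : (J • U).submoduleOf U = J • ⊤ := by
    apply Submodule.map_injective_of_injective U.injective_subtype
    rw [Submodule.submoduleOf, Submodule.map_comap_subtype, Submodule.map_smul'',
      Submodule.map_subtype_top, inf_eq_right]
    exact Submodule.smul_le_right
  rw [relLength, hker]
  have : Module.Finite (R ⧸ J) (↥U ⧸ J • (⊤ : Submodule R U)) := Module.Finite.of_restrictScalars_finite R _ _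
  have hsurj : Function.Surjective (algebraMap R (R ⧸ J)) := Ideal.Quotient.mk_surjective
  rw [Module.length_eq_of_surjective hsurj]
  have : IsArtinian (R ⧸ J) (↥U ⧸ J • (⊤ : Submodule R U)) := isArtinian_of_fg_of_artinian'
  exact Module.length_ne_top

end FiniteLength

/-! ### Greatest candidates -/

section Main

variable {R : Type*} [CommRing R] {F : Type*} [AddCommGroup F] [Module R F]

lemma EventuallyPolynomial.of_succ {f : ℕ → ℕ∞} (h : EventuallyPolynomial fun n => f (n + 1)) :
    EventuallyPolynomial f := by
  obtain ⟨P, hP⟩ := h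
  obtain ⟨N, hN⟩ := eventually_atTop.1 hP
  refine ⟨P.comp (Polynomial.X - 1), eventually_atTop.2 ⟨N + 1, fun n hn => ?_⟩⟩
  obtain ⟨n, rfl⟩ : ∃ m, n = m + 1 := ⟨n - 1, by omega⟩
  simpa using hN n (by omega)

lemma quotLength_succ (M L : Submodule R F) (n : ℕ) : quotLength M L (n + 1) =
    relLength (degOne L * degOne M ^ n) (fitt M • degOne M ^ (n + 1)) := rfl

lemma smul_degOne_le {M L : Submodule R F} {J : Ideal R} (h : J • M ≤ L) :
    J • degOne M ≤ degOne L := by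
  rw [degOne, ← Submodule.map_smul'']
  exact Submodule.map_mono h

lemma smul_pow_le_mul_pow {M L : Submodule R F} {J : Ideal R} (h : J • M ≤ L) (n : ℕ) :
    J • degOne M ^ (n + 1) ≤ degOne L * degOne M ^ n := by
  rw [pow_succ', ideal_smul_mul]
  exact mul_le_mul' (smul_degOne_le h) le_rfl

lemma quotLength_fitt_smul (M : Submodule R F) (n : ℕ) :
    quotLength M (fitt M • M) (n + 1) = 0 := by
  rw [quotLength_succ]
  apply relLength_eq_zero
  rw [degOne, Submodule.map_smul'', ← ideal_smul_mul, pow_succ']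
  rfl

lemma quotLength_sup_le {M L L' : Submodule R F} (hL : fitt M • M ≤ L) (hL' : fitt M • M ≤ L')
    (n : ℕ) : quotLength M (L ⊔ L') (n + 1) ≤ quotLength M L (n + 1) + quotLength M L' (n + 1) := by
  simp only [quotLength_succ]
  rw [degOne, Submodule.map_sup, Submodule.sup_mul]
  exact relLength_sup_le (smul_pow_le_mul_pow hL n) (smul_pow_le_mul_pow hL' n)

variable [IsLocalRing R] [IsNoetherianRing R] [Module.Finite R F]

theorem eventuallyPolynomial_quotLength {M L : Submodule R F}
    (hM : Module.length R (F ⧸ M) ≠ ⊤) (hL : fitt M • M ≤ L) (hLM : L ≤ M) :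
    EventuallyPolynomial (quotLength M L) := by
  have : IsArtinianRing (R ⧸ fitt M) := isArtinianRing_quotient_fittingIdealZero hM
  have hfg : (degOne M).FG := (IsNoetherian.noetherian M).map _
  have hle : degOne L ≤ degOne M := Submodule.map_mono hLM
  refine EventuallyPolynomial.of_succ ?_
  refine eventuallyPolynomial_relLength_mul_pow hfg (smul_degOne_le hL) hle fun n => ?_
  refine ne_top_of_le_ne_top (relLength_smul_ne_top (J := fitt M) (hfg.pow (n + 1)))
    (relLength_mono (smul_pow_le_mul_pow hL n) ?_)
  rw [pow_succ']
  exact mul_le_mul' hle le_rfl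

lemma sup_mem_coeffCandidates {M : Submodule R F} (hM : Module.length R (F ⧸ M) ≠ ⊤) {s k : ℕ}
    {L L' : Submodule R F} (hL : L ∈ coeffCandidates M s k) (hL' : L' ∈ coeffCandidates M s k) :
    L ⊔ L' ∈ coeffCandidates M s k := by
  have h1 := le_sup_of_le_left (b := L') hL.1
  have h2 := sup_le hL.2.1 hL'.2.1
  refine ⟨h1, h2, .of_le_add (eventuallyPolynomial_quotLength hM h1 h2) hL.2.2 hL'.2.2 ?_⟩
  refine eventually_atTop.2 ⟨1, fun n hn => ?_⟩
  obtain ⟨n, rfl⟩ : ∃ m, n = m + 1 := ⟨n - 1, by omega⟩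
  exact quotLength_sup_le hL.1 hL'.1 n

lemma fitt_smul_mem_coeffCandidates {R : Type*} [CommRing R] {F : Type*} [AddCommGroup F]
    [Module R F] (M : Submodule R F) (s k : ℕ) :
    fitt M • M ∈ coeffCandidates M s k := by
  refine ⟨le_rfl, Submodule.smul_le_right, 0, Or.inl rfl,
    eventually_atTop.2 ⟨1, fun n hn => ⟨0, ?_, by simp⟩⟩⟩
  obtain ⟨n, rfl⟩ : ∃ m, n = m + 1 := ⟨n - 1, by omega⟩
  exact quotLength_fitt_smul M n

lemma exists_isGreatest_coeffCandidates {M : Submodule R F}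
    (hM : Module.length R (F ⧸ M) ≠ ⊤) (s k : ℕ) :
    ∃ C, IsGreatest (coeffCandidates M s k) C := by
  obtain ⟨C, hC⟩ := exists_maximal_of_wellFoundedGT (· ∈ coeffCandidates M s k)
    ⟨_, fitt_smul_mem_coeffCandidates M s k⟩
  exact ⟨C, hC.1, fun L hL =>
    le_sup_right.trans (hC.2 (sup_mem_coeffCandidates hM hC.1 hL) le_sup_left)⟩

lemma coeffCandidates_succ_subset {R : Type*} [CommRing R] {F : Type*} [AddCommGroup F]
    [Module R F] (M : Submodule R F) (s k : ℕ) :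
    coeffCandidates M s (k + 1) ⊆ coeffCandidates M s k := by
  rintro L ⟨h1, h2, P, hP, h⟩
  refine ⟨h1, h2, P, hP.imp_right fun hP => ?_, h⟩
  push_cast at hP
  omega

end Main

end CoeffModule

theorem mainTheorem4 {R : Type*} [CommRing R] [IsLocalRing R] [IsNoetherianRing R]
    [Infinite (IsLocalRing.ResidueField R)]
    {F : Type*} [AddCommGroup F] [Module R F] [Module.Free R F] [Module.Finite R F] [Nontrivial F]
    (M : Submodule R F) (hM : Module.length R (F ⧸ M) < ⊤)
    (s : ℕ) (hs : CoeffModule.analyticSpread M = (s : WithBot ℕ∞)) (hs1 : 1 ≤ s) :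
    ∃ C : ℕ → Submodule R F,
      (∀ k : ℕ, 1 ≤ k → k ≤ s →
        IsGreatest (CoeffModule.coeffCandidates M s k) (C k) ∧
        ∀ L : Submodule R F, IsGreatest (CoeffModule.coeffCandidates M s k) L → L = C k) ∧
      CoeffModule.fitt M • M ≤ C s ∧
      (∀ k : ℕ, 1 ≤ k → k + 1 ≤ s → C (k + 1) ≤ C k) ∧
      C 1 ≤ M := by
  choose C hC using CoeffModule.exists_isGreatest_coeffCandidates hM.ne s
  exact ⟨C, fun k _ _ => ⟨hC k, fun L hL => hL.unique (hC k)⟩, (hC s).1.1,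
    fun k _ _ => (hC k).2 (CoeffModule.coeffCandidates_succ_subset M s k (hC (k + 1)).1),
    (hC 1).1.2.1⟩
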